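/- Let $\Gamma$ be an infinite set and let $\mu_{xy}=\mu_{yx}\ge 0$ $(x,y\in\Gamma)$ be a symmetric weight. Write $x\sim y$ if $\mu_{xy}>0$ (loops $x\sim x$ are allowed) and assume that the resulting graph is connected and locally uniformly finite, i.e. $\sup_{x\in\Gamma}\#\{y : y\sim x\}<\infty$. Let $d$ be the graph distance, $B(x,r)=\{y : d(x,y)<r\}$, $m(x)=\sum_{y\sim x}\mu_{xy}$, $V(x,r)=\sum_{y\in B(x,r)}m(y)$ and, for $1\le p<\infty$, $\|f\|_{L^p}=\big(\sum_{x\in\Gamma}|f(x)|^p m(x)\big)^{1/p}$. Put $p(x,y)=\frac{\mu_{xy}}{m(x)m(y)}$ and, for real- or complex-valued functions $f$ on $\Gamma$, \[ Pf(x)=\sum_{y\in\Gamma}p(x,y)f(y)m(y),\qquad \nabla f(x)=\Big(\tfrac12\sum_{y\in\Gamma}p(x,y)|f(y)-f(x)|^2m(y)\Big)^{1/2},\qquad \tilde g_0f(x)=\Big(\sum_{l\ge1}|\nabla P^{l-1}f(x)|^2\Big)^{1/2}. \] Assume that (LB) there exists $\epsilon>0$ such that $\mu_{xx}\ge\epsilon\,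 m(x)$ for all $x\in\Gamma$, and (LDV) there exists $c>0$ such that $V(x,2)\le c\,m(x)$ for all $x\in\Gamma$. Then $\tilde g_0$ is $L^p$-bounded for every $p\in(1,2]$: there exists a constant $C<\infty$ such that $\|\tilde g_0f\|_{L^p}\le C\|f\|_{L^p}$ for all $f\in L^p(\Gamma)$. -/

import Mathlib

open scoped ENNReal NNReal

noncomputable section

/-- A weighted unoriented graph on the vertex set `Γ`: a symmetric nonnegative weight `μ`, where
`x ∼ y` means `0 < μ x y` (loops `x ∼ x` are allowed), connected and locally uniformly finite. -/
structure WeightedGraph (Γ : Type*) where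
  /-- the weight of the pair `(x, y)` -/
  μ : Γ → Γ → ℝ
  symm : ∀ x y, μ x y = μ y x
  nonneg : ∀ x y, 0 ≤ μ x y
  /-- any two vertices are joined by a finite path of neighbors -/
  connected : ∀ x y, Relation.ReflTransGen (fun a b => 0 < μ a b) x y
  /-- the number of neighbors of a vertex is uniformly bounded -/
  locallyUniformlyFinite : ∃ M₀ : ℕ, ∀ x, {y | 0 < μ x y}.encard ≤ (M₀ : ℕ∞)

namespace WeightedGraph

variable {Γ : Type*} (G : WeightedGraph Γ)

/-- The weight `m x` of a vertex: the sum of `μ x y` over the (finitely many) neighbors `y` of `x`;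
all other terms vanish. -/
def m (x : Γ) : ℝ := ∑' y, G.μ x y

/-- The underlying loopless graph. It has the same shortest paths as the weighted graph. -/
def toSimpleGraph : SimpleGraph Γ where
  Adj x y := x ≠ y ∧ 0 < G.μ x y
  symm := ⟨fun x y h => ⟨h.1.symm, G.symm x y ▸ h.2⟩⟩
  loopless := ⟨fun _ h => h.1 rfl⟩

/-- The graph metric: the length of a shortest path. -/
def dist (x y : Γ) : ℕ := G.toSimpleGraph.dist x y

/-- The open ball `B(x, r) = {y | d(x, y) < r}`. -/
def ball (x : Γ) (r : ℝ) : Set Γ := {y | (G.dist x y : ℝ) < r}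

/-- The volume `m(E)` of a set of vertices, the sum of the weights of its elements. -/
def volume (E : Set Γ) : ℝ≥0∞ := ∑' x : E, ENNReal.ofReal (G.m x)

/-- The volume `V(x, r)` of a ball. -/
def V (x : Γ) (r : ℝ) : ℝ≥0∞ := G.volume (G.ball x r)

/-- The norm `(∑ |F x| ^ p m(x)) ^ (1 / p)`, with values in `[0, ∞]`, of a function with values in
`ℝ`, `ℂ` or `[0, ∞]`. -/
def lpNorm {E : Type*} [ENorm E] (p : ℝ) (F : Γ → E) : ℝ≥0∞ :=
  (∑' x, ‖F x‖ₑ ^ p * ENNReal.ofReal (G.m x)) ^ (1 / p)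

/-- `f` belongs to `L^p(Γ, m)`. -/
def MemLp {E : Type*} [ENorm E] (p : ℝ) (f : Γ → E) : Prop := G.lpNorm p f < ∞

/-- The Markov kernel `p(x, y) = μ_{xy} / (m(x) m(y))`. -/
def kernel (x y : Γ) : ℝ := G.μ x y / (G.m x * G.m y)

/-- The Markov operator `P f(x) = ∑_y p(x, y) f(y) m(y)`; only the finitely many neighbors `y` of
`x` contribute. -/
def P {𝕜 : Type*} [RCLike 𝕜] (f : Γ → 𝕜) (x : Γ) : 𝕜 :=
  ∑' y, ((G.kernel x y * G.m y : ℝ) : 𝕜) * f y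

/-- The length of the gradient, `∇f(x) = (1/2 ∑_y p(x, y) |f(y) - f(x)|² m(y)) ^ (1/2)`. -/
def grad {𝕜 : Type*} [RCLike 𝕜] (f : Γ → 𝕜) (x : Γ) : ℝ :=
  Real.sqrt (1 / 2 * ∑' y, G.kernel x y * ‖f y - f x‖ ^ 2 * G.m y)

/-- The vertical functional `g̃₀ f(x) = (∑_{l ≥ 1} |∇ P^{l-1} f(x)|²) ^ (1/2)`, with values in
`[0, ∞]`. The sum is indexed by `n = l - 1`. -/
def gTildeZero {𝕜 : Type*} [RCLike 𝕜] (f : Γ → 𝕜) (x : Γ) : ℝ≥0∞ :=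
  (∑' n : ℕ, ENNReal.ofReal (G.grad (G.P^[n] f) x) ^ 2) ^ (1 / 2 : ℝ)

/-- Condition (LB): `μ_{xx} ≥ ε m(x)` for all `x`, for some `ε > 0`. -/
def LB : Prop := ∃ ε : ℝ, 0 < ε ∧ ∀ x, ε * G.m x ≤ G.μ x x

/-- Local doubling (LDV): `V(x, 2) ≤ c m(x)` for all `x`, for some `c > 0`. -/
def LDV : Prop := ∃ c : ℝ, 0 < c ∧ ∀ x, G.V x 2 ≤ ENNReal.ofReal (c * G.m x)

end WeightedGraph

end

/-! For `1 < p ≤ 2` the function `t ↦ t ^ p` is strongly convex on `[0, M]`, with modulus of order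
`M ^ (p - 2)`. So if `|u| ≤ M` on the neighbors of `x`, the Jensen defect `P(|u|^p)(x) - |Pu(x)|^p`
dominates `M ^ (p - 2)` times the variance of `u` under the transition law at `x`
(`mul_variance_le_rpow_defect`). By (LB) the walk stays at `x` with probability at least `ε`, so
this variance controls `|∇u(x)|²` (`sum_norm_sub_sq_le_variance`).

Apply this to `u = P^n f`, with `M = N(x)` the supremum over the neighbors of `x` of the maximal
function `sup_n P^n|f|`. This `M` does not depend on `n`, so summation gives `g̃₀f(x)² ≤ K
N(x)^(2-p) J(x)`, where `J` is the sum over `n` of the defects of `P^n f`. Since `m` is invariant,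
these defects telescope and `∑ m J ≤ ‖f‖_p^p` (`tsum_tsum_jensenDefect_le`). Raising to the power `p
/ 2` and separating the two factors leaves only an `L^p` bound for `N`. (LDV) removes the supremum
over neighbors (`tsum_iSup_neighbor_rpow_le`), and a maximal inequality does the rest
(`exists_maximal_le`).

The maximal inequality follows Rota and Stein. For the stationary reversible chain, `P^{2j} f(X 0)`
is the conditional expectation given `X 0` of `P^j f(X j)`, a reversed martingale, so Doob's
inequality bounds the supremum over even powers. (LB) reduces odd powers to even ones. The chain is
encoded by finite iterated averages, without a path space. -/

/-! ### Markov operators on `[0, ∞]`-valued functions -/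

/-- The average `∑ y, k x y * g y` of a `[0, ∞]`-valued function against a kernel. -/
noncomputable def kernelAverage {Γ : Type*} (k : Γ → Γ → ℝ≥0∞) (g : Γ → ℝ≥0∞) (x : Γ) : ℝ≥0∞ :=
  ∑' y, k x y * g y

/-- A kernel with finitely supported probability rows, reversible for the positive weight `w`. -/
structure IsReversibleKernel {Γ : Type*} (k : Γ → Γ → ℝ≥0∞) (w : Γ → ℝ≥0∞) : Prop where
  finite_support : ∀ x, {y | k x y ≠ 0}.Finite
  tsum_eq_one : ∀ x, ∑' y, k x y = 1
  reversible : ∀ x y, w x * k x y = w y * k y x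
  weight_ne_zero : ∀ x, w x ≠ 0

section kernelAverage

variable {Γ : Type*} {k : Γ → Γ → ℝ≥0∞} {w : Γ → ℝ≥0∞}

lemma kernelAverage_mono {g h : Γ → ℝ≥0∞} (hgh : ∀ x, g x ≤ h x) (x : Γ) :
    kernelAverage k g x ≤ kernelAverage k h x :=
  ENNReal.tsum_le_tsum fun y => mul_le_mul_right (hgh y) _

lemma kernelAverage_add (g h : Γ → ℝ≥0∞) (x : Γ) :
    kernelAverage k (fun y => g y + h y) x = kernelAverage k g x + kernelAverage k h x := by
  simp only [kernelAverage, mul_add, ENNReal.tsum_add]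

lemma kernelAverage_const_mul (c : ℝ≥0∞) (g : Γ → ℝ≥0∞) (x : Γ) :
    kernelAverage k (fun y => c * g y) x = c * kernelAverage k g x := by
  simp only [kernelAverage, ← ENNReal.tsum_mul_left]
  exact tsum_congr fun y => by ring

lemma kernelAverage_tsum {ι : Type*} (g : ι → Γ → ℝ≥0∞) (x : Γ) :
    kernelAverage k (fun y => ∑' i, g i y) x = ∑' i, kernelAverage k (g i) x := by
  simp only [kernelAverage, ← ENNReal.tsum_mul_left]
  exact ENNReal.tsum_comm

namespace IsReversibleKernel

variable (hk : IsReversibleKernel k w)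
include hk

lemma kernelAverage_const (c : ℝ≥0∞) (x : Γ) : kernelAverage k (fun _ => c) x = c := by
  simp only [kernelAverage, ENNReal.tsum_mul_right, hk.tsum_eq_one, one_mul]

/-- The averaging operator is symmetric for the weight `w`. -/
lemma tsum_mul_kernelAverage (φ g : Γ → ℝ≥0∞) :
    ∑' x, w x * (φ x * kernelAverage k g x) = ∑' x, w x * (kernelAverage k φ x * g x) := by
  have h1 : ∀ x, w x * (φ x * kernelAverage k g x) = ∑' y, w x * k x y * (φ x * g y) := by
    intro x
    rw [kernelAverage, ← ENNReal.tsum_mul_left, ← ENNReal.tsum_mul_left]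
    exact tsum_congr fun y => by ring
  have h2 : ∀ x, w x * (kernelAverage k φ x * g x) = ∑' y, w x * k x y * (φ y * g x) := by
    intro x
    rw [kernelAverage, ← ENNReal.tsum_mul_right, ← ENNReal.tsum_mul_left]
    exact tsum_congr fun y => by ring
  simp only [h1, h2]
  rw [ENNReal.tsum_comm]
  exact tsum_congr fun x => tsum_congr fun y => by rw [hk.reversible]

lemma tsum_mul_kernelAverage_iterate (φ g : Γ → ℝ≥0∞) (n : ℕ) :
    ∑' x, w x * (φ x * (kernelAverage k)^[n] g x)
      = ∑' x, w x * ((kernelAverage k)^[n] φ x * g x) := by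
  induction n generalizing φ with
  | zero => rfl
  | succ n ih =>
    rw [Function.iterate_succ_apply', hk.tsum_mul_kernelAverage, ih, Function.iterate_succ_apply]

/-- The weight `w` is invariant. -/
lemma tsum_kernelAverage (g : Γ → ℝ≥0∞) :
    ∑' x, w x * kernelAverage k g x = ∑' x, w x * g x := by
  simpa [hk.kernelAverage_const] using hk.tsum_mul_kernelAverage (fun _ => 1) g

lemma tsum_kernelAverage_iterate (g : Γ → ℝ≥0∞) (n : ℕ) :
    ∑' x, w x * (kernelAverage k)^[n] g x = ∑' x, w x * g x := by
  induction n with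
  | zero => rfl
  | succ n ih => rw [Function.iterate_succ_apply', hk.tsum_kernelAverage, ih]

lemma kernelAverage_eq_sum (g : Γ → ℝ≥0∞) (x : Γ) :
    kernelAverage k g x = ∑ y ∈ (hk.finite_support x).toFinset, k x y * g y := by
  refine tsum_eq_sum fun y hy => ?_
  have : k x y = 0 := by simpa using hy
  rw [this, zero_mul]

lemma kernelAverage_rpow_le {p : ℝ} (hp : 1 ≤ p) (g : Γ → ℝ≥0∞) (x : Γ) :
    kernelAverage k g x ^ p ≤ kernelAverage k (fun y => g y ^ p) x := by
  rw [hk.kernelAverage_eq_sum, hk.kernelAverage_eq_sum]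
  refine ENNReal.rpow_arith_mean_le_arith_mean_rpow _ _ _ ?_ hp
  have := hk.kernelAverage_eq_sum (fun _ => 1) x
  simpa [hk.kernelAverage_const] using this.symm

lemma tsum_kernelAverage_iterate_rpow_le {p : ℝ} (hp : 1 ≤ p) (g : Γ → ℝ≥0∞) (n : ℕ) :
    ∑' x, w x * (kernelAverage k)^[n] g x ^ p ≤ ∑' x, w x * g x ^ p := by
  induction n with
  | zero => rfl
  | succ n ih =>
    refine le_trans ?_ ih
    rw [← hk.tsum_kernelAverage (fun x => (kernelAverage k)^[n] g x ^ p)]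
    simp only [Function.iterate_succ_apply']
    exact ENNReal.tsum_le_tsum fun x => mul_le_mul_right (hk.kernelAverage_rpow_le hp _ x) _

lemma ne_top_of_tsum_rpow_ne_top {p : ℝ} (hp : 0 < p) {g : Γ → ℝ≥0∞}
    (hg : ∑' x, w x * g x ^ p ≠ ∞) (x : Γ) : g x ≠ ∞ := by
  intro h
  have := ENNReal.ne_top_of_tsum_ne_top hg x
  rw [h, ENNReal.top_rpow_of_pos hp, ENNReal.mul_top (hk.weight_ne_zero x)] at this
  exact this rfl

end IsReversibleKernel

end kernelAverage

/-! ### Elementary inequalities for powers -/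

lemma ENNReal.rpow_eq_rpow_sub_one_mul {p : ℝ} (hp : 1 ≤ p) (t : ℝ≥0∞) :
    t ^ p = t ^ (p - 1) * t := by
  conv_rhs => rw [← ENNReal.rpow_one t]
  rw [← ENNReal.rpow_mul, one_mul, ← ENNReal.rpow_add_of_nonneg _ _ (by linarith) zero_le_one]
  congr 1; ring

/-- An absorption form of Young's inequality: if `2cb ≤ a` the first term on the right suffices, and
otherwise `a ≤ 2cb` and the second does. -/
lemma ENNReal.mul_rpow_mul_le {p : ℝ} (hp : 1 < p) {c : ℝ≥0∞} (a b : ℝ≥0∞) :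
    c * (a ^ (p - 1) * b) ≤ a ^ p / 2 + c * (2 * c) ^ (p - 1) * b ^ p := by
  have hsplit := fun t => ENNReal.rpow_eq_rpow_sub_one_mul (p := p) hp.le t
  rcases le_total (2 * c * b) a with h | h
  · refine le_add_right ?_
    rw [ENNReal.le_div_iff_mul_le (by simp) (by simp), hsplit a]
    calc c * (a ^ (p - 1) * b) * 2 = a ^ (p - 1) * (2 * c * b) := by ring
      _ ≤ a ^ (p - 1) * a := mul_le_mul_right h _
  · refine le_add_left ?_
    calc c * (a ^ (p - 1) * b) ≤ c * ((2 * c * b) ^ (p - 1) * b) := by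
          gcongr
      _ = c * (2 * c) ^ (p - 1) * b ^ p := by
          rw [ENNReal.mul_rpow_of_nonneg _ _ (by linarith), hsplit b]; ring

/-- One step of Doob's inequality. With `M = max s u` it reads `M^p - s^p ≤ q (M^(p-1) - s^(p-1))
u`, written without subtraction. Only `s ≤ u` needs an argument, namely Young's inequality and `q /
p + 1 = q`. -/
lemma ENNReal.max_rpow_add_le {p q : ℝ} (hpq : p.HolderConjugate q) (s u : ℝ≥0∞) :
    max s u ^ p + ENNReal.ofReal q * (s ^ (p - 1) * u)
      ≤ ENNReal.ofReal q * (max s u ^ (p - 1) * u) + s ^ p := by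
  have hsplit := fun t => ENNReal.rpow_eq_rpow_sub_one_mul (p := p) hpq.lt.le t
  rcases le_total u s with h | h
  · rw [max_eq_left h, add_comm]
  · rw [max_eq_right h, ← hsplit u]
    have hy := ENNReal.young_inequality (s ^ (p - 1)) u hpq.symm
    rw [← ENNReal.rpow_mul, hpq.sub_one_mul_conj] at hy
    have hq : 0 < q := hpq.symm.pos
    have hq0 : ENNReal.ofReal q ≠ 0 := by simpa using hq
    have hqp : ENNReal.ofReal q * (u ^ p / ENNReal.ofReal p) + u ^ p
        = ENNReal.ofReal q * u ^ p := by
      have : ENNReal.ofReal q * (ENNReal.ofReal p)⁻¹ + 1 = ENNReal.ofReal q := by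
        rw [← ENNReal.ofReal_inv_of_pos hpq.pos, ← ENNReal.ofReal_mul hq.le,
          ← ENNReal.ofReal_one, ← ENNReal.ofReal_add (by have := hpq.pos; positivity) zero_le_one]
        congr 1
        have := hpq.inv_add_inv_eq_one
        have h0 := hpq.pos
        field_simp at this ⊢
        linarith
      conv_rhs => rw [← this]
      rw [div_eq_mul_inv]; ring
    calc u ^ p + ENNReal.ofReal q * (s ^ (p - 1) * u)
        ≤ u ^ p + ENNReal.ofReal q * (s ^ p / ENNReal.ofReal q + u ^ p / ENNReal.ofReal p) := by
          gcongr
      _ = ENNReal.ofReal q * u ^ p + s ^ p := by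
          rw [mul_add, ENNReal.mul_div_cancel hq0 ENNReal.ofReal_ne_top, ← hqp]; ring

lemma ENNReal.le_two_mul_of_le_half_add {a b : ℝ≥0∞} (ha : a ≠ ∞) (h : a ≤ a / 2 + b) :
    a ≤ 2 * b := by
  have h2 : a / 2 ≠ ∞ := ENNReal.div_ne_top ha (by simp)
  have h3 : a / 2 + a / 2 ≤ a / 2 + b := by rwa [ENNReal.add_halves]
  rw [ENNReal.add_le_add_iff_left h2] at h3
  calc a = a / 2 + a / 2 := (ENNReal.add_halves a).symm
    _ ≤ b + b := add_le_add h3 h3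
    _ = 2 * b := (two_mul b).symm

/-! ### The maximal inequality for even powers of a reversible Markov operator

The inequality is Doob's, applied to the reversed martingale `n ↦ P^n f (X n)`. -/

/-- The expectation of `Ψ (X 0) (S 0)`, where `X n, X (n - 1), …, X 0` is the Markov chain with
kernel `k` started at `X n = x`, and `S j = max s (u (n - 1) (X (n - 1))) … (u j (X j))`. -/
noncomputable def runningMaxExpectation {Γ : Type*} (k : Γ → Γ → ℝ≥0∞) (u : ℕ → Γ → ℝ≥0∞) :
    ℕ → (Γ → ℝ≥0∞ → ℝ≥0∞) → Γ → ℝ≥0∞ → ℝ≥0∞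
  | 0, Ψ => Ψ
  | n + 1, Ψ => fun x s =>
      kernelAverage k (fun y => runningMaxExpectation k u n Ψ y (max s (u n y))) x

section runningMaxExpectation

variable {Γ : Type*} {k : Γ → Γ → ℝ≥0∞} {w : Γ → ℝ≥0∞} {u : ℕ → Γ → ℝ≥0∞}

lemma runningMaxExpectation_mono {Ψ Φ : Γ → ℝ≥0∞ → ℝ≥0∞} (h : ∀ x s, Ψ x s ≤ Φ x s) (n : ℕ)
    (x : Γ) (s : ℝ≥0∞) :
    runningMaxExpectation k u n Ψ x s ≤ runningMaxExpectation k u n Φ x s := by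
  induction n generalizing x s with
  | zero => exact h x s
  | succ n ih => exact kernelAverage_mono (fun y => ih y _) x

lemma runningMaxExpectation_add (Ψ Φ : Γ → ℝ≥0∞ → ℝ≥0∞) (n : ℕ) (x : Γ) (s : ℝ≥0∞) :
    runningMaxExpectation k u n (fun x s => Ψ x s + Φ x s) x s
      = runningMaxExpectation k u n Ψ x s + runningMaxExpectation k u n Φ x s := by
  induction n generalizing x s with
  | zero => rfl
  | succ n ih => simp only [runningMaxExpectation, ih, kernelAverage_add]

lemma runningMaxExpectation_const_mul (c : ℝ≥0∞) (Ψ : Γ → ℝ≥0∞ → ℝ≥0∞) (n : ℕ) (x : Γ)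
    (s : ℝ≥0∞) :
    runningMaxExpectation k u n (fun x s => c * Ψ x s) x s
      = c * runningMaxExpectation k u n Ψ x s := by
  induction n generalizing x s with
  | zero => rfl
  | succ n ih => simp only [runningMaxExpectation, ih, kernelAverage_const_mul]

lemma runningMaxExpectation_tsum {ι : Type*} (Ψ : ι → Γ → ℝ≥0∞ → ℝ≥0∞) (n : ℕ) (x : Γ)
    (s : ℝ≥0∞) :
    runningMaxExpectation k u n (fun x s => ∑' i, Ψ i x s) x s
      = ∑' i, runningMaxExpectation k u n (Ψ i) x s := by
  induction n generalizing x s with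
  | zero => rfl
  | succ n ih => simp only [runningMaxExpectation, ih, kernelAverage_tsum]

lemma runningMaxExpectation_fst (g : Γ → ℝ≥0∞) (n : ℕ) (x : Γ) (s : ℝ≥0∞) :
    runningMaxExpectation k u n (fun x _ => g x) x s = (kernelAverage k)^[n] g x := by
  induction n generalizing x s with
  | zero => rfl
  | succ n ih => simp only [runningMaxExpectation, ih, Function.iterate_succ_apply']

/-- The running maximum never drops below its initial value. -/
lemma mul_le_runningMaxExpectation (φ : Γ → ℝ≥0∞) (n : ℕ) (x : Γ) (s : ℝ≥0∞) :
    s * (kernelAverage k)^[n] φ x ≤ runningMaxExpectation k u n (fun x s => φ x * s) x s := by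
  induction n generalizing x s with
  | zero => exact (mul_comm _ _).le
  | succ n ih =>
    rw [Function.iterate_succ_apply', ← kernelAverage_const_mul]
    refine kernelAverage_mono (fun y => le_trans ?_ (ih y _)) x
    exact mul_le_mul_left (le_max_left _ _) _

/-- The left side is the expectation of `u j (X j) * φ (X 0)`, and from time `j` on the running
maximum is at least `u j (X j)`. -/
lemma kernelAverage_iterate_le_runningMaxExpectation (φ : Γ → ℝ≥0∞) (j i : ℕ) (x : Γ)
    (s : ℝ≥0∞) :
    (kernelAverage k)^[i + 1] (fun y => u j y * (kernelAverage k)^[j] φ y) x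
      ≤ runningMaxExpectation k u (j + i + 1) (fun x s => φ x * s) x s := by
  induction i generalizing x s with
  | zero =>
    refine kernelAverage_mono (fun y => le_trans ?_ (mul_le_runningMaxExpectation φ j y _)) x
    exact mul_le_mul_left (le_max_right _ _) _
  | succ i ih =>
    rw [Function.iterate_succ_apply']
    exact kernelAverage_mono (fun y => ih y _) x

namespace IsReversibleKernel

variable (hk : IsReversibleKernel k w)
include hk

/-- A priori finiteness, needed to absorb the term on the right in Doob's inequality. The bound
depends on `n`: it adds up the `p`-th powers of all the `u j (X j)`. -/
lemma tsum_runningMaxExpectation_rpow_ne_top {p : ℝ} (hp : 0 < p)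
    (hu : ∀ n, ∑' x, w x * u n x ^ p ≠ ∞) (n : ℕ) :
    ∑' x, w x * runningMaxExpectation k u n (fun _ s => s ^ p) x 0 ≠ ∞ := by
  have key : ∀ n : ℕ, ∃ Q : Γ → ℝ≥0∞, ∑' x, w x * Q x ≠ ∞ ∧
      ∀ x s, runningMaxExpectation k u n (fun _ s => s ^ p) x s ≤ s ^ p + Q x := by
    intro n
    induction n with
    | zero => exact ⟨fun _ => 0, by simp, fun x s => le_self_add⟩
    | succ n ih =>
      obtain ⟨Q, hQ, hle⟩ := ih
      refine ⟨kernelAverage k (fun y => u n y ^ p + Q y), ?_, fun x s => ?_⟩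
      · rw [hk.tsum_kernelAverage]
        simp only [mul_add, ENNReal.tsum_add]
        exact ENNReal.add_ne_top.2 ⟨hu n, hQ⟩
      · rw [← hk.kernelAverage_const (s ^ p) x, ← kernelAverage_add]
        refine kernelAverage_mono (fun y => (hle y _).trans ?_) x
        rw [← add_assoc]
        gcongr
        rcases le_total s (u n y) with h | h
        · rw [max_eq_right h]; exact le_add_self
        · rw [max_eq_left h]; exact le_self_add
  obtain ⟨Q, hQ, hle⟩ := key n
  refine ne_top_of_le_ne_top hQ (ENNReal.tsum_le_tsum fun x => ?_)
  simpa [ENNReal.zero_rpow_of_pos hp] using mul_le_mul_right (hle x 0) (w x)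

/-- Doob's inequality for the reversed martingale, in the form of a supersolution. -/
lemma runningMaxExpectation_rpow_add_le {p q : ℝ} (hpq : p.HolderConjugate q)
    (hu : ∀ n x, u n x ≠ ∞) (hsucc : ∀ n x, u (n + 1) x = kernelAverage k (u n) x) (n : ℕ)
    (x : Γ) (s : ℝ≥0∞) (hs : s ≠ ∞) :
    runningMaxExpectation k u n (fun _ s => s ^ p) x s
        + ENNReal.ofReal q * (s ^ (p - 1) * u n x)
      ≤ ENNReal.ofReal q * runningMaxExpectation k u n (fun x s => s ^ (p - 1) * u 0 x) x s
        + s ^ p := by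
  induction n generalizing x s with
  | zero => exact (add_comm _ _).le
  | succ n ih =>
    have hstep : ENNReal.ofReal q * (s ^ (p - 1) * u (n + 1) x)
        = kernelAverage k (fun y => ENNReal.ofReal q * (s ^ (p - 1) * u n y)) x := by
      rw [hsucc, kernelAverage_const_mul, kernelAverage_const_mul]
    rw [hstep, ← hk.kernelAverage_const (s ^ p) x]
    simp only [runningMaxExpectation]
    rw [← kernelAverage_const_mul, ← kernelAverage_add, ← kernelAverage_add]
    refine kernelAverage_mono (fun y => ?_) x
    have hmax : max s (u n y) ≠ ∞ := by
      rcases max_choice s (u n y) with h | h <;> rw [h]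
      exacts [hs, hu n y]
    have h1 := ih y (max s (u n y)) hmax
    have h2 := ENNReal.max_rpow_add_le hpq s (u n y)
    -- These terms occur on opposite sides of `h1` and `h2`; cancelling them in `[0, ∞]` requires
    -- finiteness.
    have hfin : max s (u n y) ^ p + ENNReal.ofReal q * (max s (u n y) ^ (p - 1) * u n y) ≠ ∞ := by
      refine ENNReal.add_ne_top.2 ⟨ENNReal.rpow_ne_top_of_nonneg hpq.nonneg hmax, ?_⟩
      exact ENNReal.mul_ne_top ENNReal.ofReal_ne_top (ENNReal.mul_ne_top
        (ENNReal.rpow_ne_top_of_nonneg hpq.sub_one_pos.le hmax) (hu n y))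
    rw [← ENNReal.add_le_add_iff_right hfin]
    calc _ = (runningMaxExpectation k u n (fun _ s => s ^ p) y (max s (u n y))
            + ENNReal.ofReal q * (max s (u n y) ^ (p - 1) * u n y))
          + (max s (u n y) ^ p + ENNReal.ofReal q * (s ^ (p - 1) * u n y)) := by ring
      _ ≤ _ := add_le_add h1 h2
      _ = _ := by ring

end IsReversibleKernel

end runningMaxExpectation

namespace IsReversibleKernel

variable {Γ : Type*} {k : Γ → Γ → ℝ≥0∞} {w : Γ → ℝ≥0∞} (hk : IsReversibleKernel k w)
include hk

lemma tsum_runningMaxExpectation_rpow_le {p q : ℝ} (hpq : p.HolderConjugate q) {f : Γ → ℝ≥0∞}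
    (hf : ∑' x, w x * f x ^ p ≠ ∞) (n : ℕ) :
    ∑' x, w x * runningMaxExpectation k (fun n => (kernelAverage k)^[n] f) n
        (fun _ s => s ^ p) x 0
      ≤ 2 * (ENNReal.ofReal q * (2 * ENNReal.ofReal q) ^ (p - 1) * ∑' x, w x * f x ^ p) := by
  set u : ℕ → Γ → ℝ≥0∞ := fun n => (kernelAverage k)^[n] f with hu
  set c := ENNReal.ofReal q with hc
  have hup : ∀ n, ∑' x, w x * u n x ^ p ≠ ∞ := fun n =>
    ne_top_of_le_ne_top hf (hk.tsum_kernelAverage_iterate_rpow_le hpq.lt.le f n)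
  refine ENNReal.le_two_mul_of_le_half_add
    (hk.tsum_runningMaxExpectation_rpow_ne_top hpq.pos hup n) ?_
  have key : ∀ x, runningMaxExpectation k u n (fun _ s => s ^ p) x 0
      ≤ runningMaxExpectation k u n (fun _ s => s ^ p) x 0 / 2
        + c * (2 * c) ^ (p - 1) * (kernelAverage k)^[n] (fun x => f x ^ p) x := by
    intro x
    -- Starting the running maximum at `0` makes both boundary terms vanish.
    have h := hk.runningMaxExpectation_rpow_add_le hpq
      (fun n => hk.ne_top_of_tsum_rpow_ne_top hpq.pos (hup n))
      (fun n x => by rw [hu]; simp only [Function.iterate_succ_apply']) n x 0 (by simp)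
    rw [ENNReal.zero_rpow_of_pos hpq.sub_one_pos, ENNReal.zero_rpow_of_pos hpq.pos, zero_mul,
      mul_zero, add_zero, add_zero] at h
    refine h.trans ?_
    rw [div_eq_mul_inv, mul_comm _ (2⁻¹ : ℝ≥0∞), ← runningMaxExpectation_const_mul,
      ← runningMaxExpectation_const_mul,
      ← runningMaxExpectation_fst (u := u) (fun x => f x ^ p) n x 0,
      ← runningMaxExpectation_const_mul, ← runningMaxExpectation_add]
    refine runningMaxExpectation_mono (fun y s => ?_) n x 0
    refine (ENNReal.mul_rpow_mul_le hpq.lt s (u 0 y)).trans ?_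
    rw [div_eq_mul_inv, mul_comm (s ^ p)]
    exact le_rfl
  calc _ ≤ ∑' x, w x * (runningMaxExpectation k u n (fun _ s => s ^ p) x 0 / 2
        + c * (2 * c) ^ (p - 1) * (kernelAverage k)^[n] (fun x => f x ^ p) x) :=
        ENNReal.tsum_le_tsum fun x => mul_le_mul_right (key x) _
    _ = _ := by
      simp only [mul_add, ENNReal.tsum_add]
      congr 1
      · rw [div_eq_mul_inv, ← ENNReal.tsum_mul_right]
        exact tsum_congr fun x => by rw [div_eq_mul_inv]; ring
      · rw [← hk.tsum_kernelAverage_iterate (fun x => f x ^ p) n, ← ENNReal.tsum_mul_left]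
        exact tsum_congr fun x => by ring

/-- Rota's identity tested on a point mass `φ` at `z`: by symmetry half of the powers move to `φ`,
and by invariance `i + 1` further averages, the steps from `X n` down to `X j`, cost nothing. -/
lemma mul_iterate_le_tsum_runningMaxExpectation (f : Γ → ℝ≥0∞) {j n : ℕ} (hj : j < n) [DecidableEq Γ]
    (z : Γ) :
    w z * (kernelAverage k)^[2 * j] f z ≤
      ∑' x, w x * runningMaxExpectation k (fun n => (kernelAverage k)^[n] f) n
        (fun x s => Pi.single (M := fun _ => ℝ≥0∞) z 1 x * s) x 0 := by
  obtain ⟨i, rfl⟩ : ∃ i, n = j + i + 1 := ⟨n - j - 1, by omega⟩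
  set φ : Γ → ℝ≥0∞ := Pi.single z 1 with hφ
  calc w z * (kernelAverage k)^[2 * j] f z
      = ∑' x, w x * (φ x * (kernelAverage k)^[2 * j] f x) := by
        rw [tsum_eq_single z fun x hx => by simp [hφ, hx]]
        simp [hφ]
    _ = ∑' x, w x * ((kernelAverage k)^[i + 1]
          (fun y => (kernelAverage k)^[j] f y * (kernelAverage k)^[j] φ y) x) := by
        rw [two_mul, Function.iterate_add_apply, hk.tsum_mul_kernelAverage_iterate,
          hk.tsum_kernelAverage_iterate]
        exact tsum_congr fun x => by ring
    _ ≤ _ := ENNReal.tsum_le_tsum fun x => mul_le_mul_right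
        (kernelAverage_iterate_le_runningMaxExpectation
          (u := fun n => (kernelAverage k)^[n] f) φ j i x 0) _

/-- Writing `h^p = h^(p-1) * h` and summing the pointwise bounds against `h^(p-1)` gives the
expectation of `h(X 0)^(p-1) * S 0`. Half of `∑ w h^p` is then absorbed, which is legitimate because
a finite supremum of `L^p` functions is in `L^p`. -/
lemma tsum_partialSups_even_rpow_le {p q : ℝ} (hpq : p.HolderConjugate q) {f : Γ → ℝ≥0∞}
    (hf : ∑' x, w x * f x ^ p ≠ ∞) (n : ℕ) :
    ∑' x, w x * partialSups (fun j => (kernelAverage k)^[2 * j] f x) n ^ p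
      ≤ 2 * (2 ^ (p - 1) * (2 * (ENNReal.ofReal q * (2 * ENNReal.ofReal q) ^ (p - 1)
        * ∑' x, w x * f x ^ p))) := by
  classical
  set h : Γ → ℝ≥0∞ := fun x => partialSups (fun j => (kernelAverage k)^[2 * j] f x) n with hh
  set u : ℕ → Γ → ℝ≥0∞ := fun n => (kernelAverage k)^[n] f with hu
  have hfin : ∑' x, w x * h x ^ p ≠ ∞ := by
    have hle : ∀ x, w x * h x ^ p
        ≤ ∑ j ∈ Finset.range (n + 1), w x * (kernelAverage k)^[2 * j] f x ^ p := by
      intro x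
      obtain ⟨j, hj, hjx⟩ : ∃ j ≤ n, h x = (kernelAverage k)^[2 * j] f x := by
        obtain ⟨j, hj, hjx⟩ := exists_partialSups_eq
          (fun j => (kernelAverage k)^[2 * j] f x) n
        exact ⟨j, hj, hjx⟩
      rw [hjx]
      exact Finset.single_le_sum (f := fun j => w x * (kernelAverage k)^[2 * j] f x ^ p)
        (fun _ _ => zero_le) (Finset.mem_range.2 (by omega))
    refine ne_top_of_le_ne_top ?_ (ENNReal.tsum_le_tsum hle)
    rw [Summable.tsum_finsetSum fun _ _ => ENNReal.summable]
    exact ENNReal.sum_ne_top.2 fun j _ =>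
      ne_top_of_le_ne_top hf (hk.tsum_kernelAverage_iterate_rpow_le hpq.lt.le f _)
  refine ENNReal.le_two_mul_of_le_half_add hfin ?_
  have hsplit := fun t => ENNReal.rpow_eq_rpow_sub_one_mul (p := p) hpq.lt.le t
  have hbound : ∀ z, w z * h z ≤ ∑' x, w x * runningMaxExpectation k u (n + 1)
      (fun x s => Pi.single (M := fun _ => ℝ≥0∞) z 1 x * s) x 0 := by
    intro z
    obtain ⟨j, hj, hjx⟩ := exists_partialSups_eq (fun j => (kernelAverage k)^[2 * j] f z) n
    rw [hh]
    simp only [hjx]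
    exact hk.mul_iterate_le_tsum_runningMaxExpectation f (Nat.lt_succ_of_le hj) z
  calc ∑' z, w z * h z ^ p = ∑' z, h z ^ (p - 1) * (w z * h z) :=
        tsum_congr fun z => by rw [hsplit]; ring
    _ ≤ ∑' z, h z ^ (p - 1) * ∑' x, w x * runningMaxExpectation k u (n + 1)
          (fun x s => Pi.single (M := fun _ => ℝ≥0∞) z 1 x * s) x 0 :=
        ENNReal.tsum_le_tsum fun z => mul_le_mul_right (hbound z) _
    _ = ∑' x, w x * runningMaxExpectation k u (n + 1) (fun x s => ∑' z, h z ^ (p - 1) *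
          (Pi.single (M := fun _ => ℝ≥0∞) z 1 x * s)) x 0 := by
        simp only [runningMaxExpectation_tsum, runningMaxExpectation_const_mul,
          ← ENNReal.tsum_mul_left]
        rw [ENNReal.tsum_comm]
        exact tsum_congr fun x => tsum_congr fun z => by ring
    _ = ∑' x, w x * runningMaxExpectation k u (n + 1) (fun x s => h x ^ (p - 1) * s) x 0 := by
        congr! 7 with x y s
        rw [tsum_eq_single y fun z hz => by simp [hz.symm]]
        simp
    _ ≤ ∑' x, w x * runningMaxExpectation k u (n + 1)
          (fun x s => 2⁻¹ * h x ^ p + 2 ^ (p - 1) * s ^ p) x 0 := by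
        refine ENNReal.tsum_le_tsum fun x => mul_le_mul_right
          (runningMaxExpectation_mono (fun y s => ?_) _ _ _) _
        have := ENNReal.mul_rpow_mul_le hpq.lt (c := 1) (h y) s
        rw [one_mul, one_mul, mul_one, div_eq_mul_inv, mul_comm (h y ^ p)] at this
        exact this
    _ = (∑' x, w x * h x ^ p) / 2 + 2 ^ (p - 1) * ∑' x, w x *
          runningMaxExpectation k u (n + 1) (fun _ s => s ^ p) x 0 := by
        simp only [runningMaxExpectation_add, runningMaxExpectation_const_mul,
          runningMaxExpectation_fst (fun x => h x ^ p), mul_add, ENNReal.tsum_add]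
        congr 1
        · rw [← hk.tsum_kernelAverage_iterate (fun x => h x ^ p) (n + 1), div_eq_mul_inv,
            ← ENNReal.tsum_mul_right]
          exact tsum_congr fun x => by ring
        · rw [← ENNReal.tsum_mul_left]
          exact tsum_congr fun x => by ring
    _ ≤ _ := by
        gcongr
        exact hk.tsum_runningMaxExpectation_rpow_le hpq hf (n + 1)

/-- The maximal inequality for the even powers of a reversible Markov operator. -/
theorem tsum_iSup_even_rpow_le {p q : ℝ} (hpq : p.HolderConjugate q) {f : Γ → ℝ≥0∞}
    (hf : ∑' x, w x * f x ^ p ≠ ∞) :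
    ∑' x, w x * (⨆ j, (kernelAverage k)^[2 * j] f x) ^ p
      ≤ 2 * (2 ^ (p - 1) * (2 * (ENNReal.ofReal q * (2 * ENNReal.ofReal q) ^ (p - 1)
        * ∑' x, w x * f x ^ p))) := by
  have h1 : ∀ x, w x * (⨆ j, (kernelAverage k)^[2 * j] f x) ^ p
      = ⨆ n, w x * partialSups (fun j => (kernelAverage k)^[2 * j] f x) n ^ p := by
    intro x
    rw [← iSup_partialSups_eq, ← ENNReal.mul_iSup]
    congr 1
    exact (ENNReal.orderIsoRpow p hpq.pos).map_iSup _
  simp only [h1]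
  -- Monotone convergence: the bound for finite suprema has a constant independent of `n`.
  rw [ENNReal.tsum_eq_iSup_sum]
  refine iSup_le fun s => ?_
  rw [ENNReal.finsetSum_iSup_of_monotone]
  · exact iSup_le fun n => (ENNReal.sum_le_tsum s).trans
      (hk.tsum_partialSups_even_rpow_le hpq hf n)
  · intro x a b hab
    have := hpq.nonneg
    dsimp only
    gcongr

end IsReversibleKernel

/-! ### Strong convexity of `t ↦ t ^ p` on bounded sets -/

section StrongConvexity

variable {p M : ℝ}

lemma hasDerivAt_rpow_sub_mul_sq (a : ℝ) {t : ℝ} (ht : 0 < t) :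
    HasDerivAt (fun t : ℝ => t ^ p - a * t ^ 2) (p * t ^ (p - 1) - 2 * a * t) t := by
  have h1 := Real.hasDerivAt_rpow_const (x := t) (p := p) (Or.inl ht.ne')
  have h2 := ((hasDerivAt_pow 2 t).const_mul a)
  refine (h1.sub h2).congr_deriv ?_
  push_cast
  ring

lemma continuous_rpow_sub_mul_sq (hp : 1 < p) (a : ℝ) :
    Continuous (fun t : ℝ => t ^ p - a * t ^ 2) :=
  (Real.continuous_rpow_const (by linarith)).sub (by fun_prop)

/-- The derivative is `p t (t^(p-2) - (p-1) M^(p-2))`, nonnegative because `p - 2 ≤ 0` and `p - 1 ≤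
1`. -/
lemma monotoneOn_rpow_sub_mul_sq (hp : 1 < p) (hp2 : p ≤ 2) (hM : 0 < M) :
    MonotoneOn (fun t : ℝ => t ^ p - p * (p - 1) / 2 * M ^ (p - 2) * t ^ 2) (Set.Icc 0 M) := by
  refine monotoneOn_of_deriv_nonneg (convex_Icc 0 M)
    (continuous_rpow_sub_mul_sq hp _).continuousOn ?_ ?_ <;> rw [interior_Icc] <;>
    rintro t ⟨h0, h1⟩
  · exact (hasDerivAt_rpow_sub_mul_sq _ h0).differentiableAt.differentiableWithinAt
  · rw [(hasDerivAt_rpow_sub_mul_sq _ h0).deriv]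
    have h2 : M ^ (p - 2) ≤ t ^ (p - 2) :=
      Real.rpow_le_rpow_of_nonpos h0 h1.le (by linarith)
    have h3 : t ^ (p - 1) = t ^ (p - 2) * t := by
      rw [← Real.rpow_add_one h0.ne']; congr 1; ring
    have h4 : 0 < M ^ (p - 2) := Real.rpow_pos_of_pos hM _
    have h5 : (p - 1) * M ^ (p - 2) ≤ t ^ (p - 2) := by nlinarith
    rw [h3]
    have : 0 ≤ p * t * (t ^ (p - 2) - (p - 1) * M ^ (p - 2)) :=
      mul_nonneg (by positivity) (by linarith)
    linarith

lemma convexOn_rpow_sub_mul_sq (hp : 1 < p) (hp2 : p ≤ 2) :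
    ConvexOn ℝ (Set.Icc 0 M) (fun t : ℝ => t ^ p - p * (p - 1) / 2 * M ^ (p - 2) * t ^ 2) := by
  set a := p * (p - 1) / 2 * M ^ (p - 2) with ha
  refine MonotoneOn.convexOn_of_deriv (convex_Icc 0 M)
    (continuous_rpow_sub_mul_sq hp _).continuousOn ?_ ?_ <;> rw [interior_Icc]
  · rintro t ⟨h0, h1⟩
    exact (hasDerivAt_rpow_sub_mul_sq _ h0).differentiableAt.differentiableWithinAt
  have hmono : MonotoneOn (fun t : ℝ => p * t ^ (p - 1) - 2 * a * t) (Set.Ioo 0 M) := by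
    have hd : ∀ t : ℝ, 0 < t → HasDerivAt (fun t : ℝ => p * t ^ (p - 1) - 2 * a * t)
        (p * ((p - 1) * t ^ (p - 2)) - 2 * a) t := by
      intro t ht
      have h1 := (Real.hasDerivAt_rpow_const (x := t) (p := p - 1) (Or.inl ht.ne')).const_mul p
      have h2 := (hasDerivAt_id t).const_mul (2 * a)
      refine (h1.sub h2).congr_deriv ?_
      rw [mul_one]; congr 4; ring
    refine monotoneOn_of_deriv_nonneg (convex_Ioo 0 M)
      (fun t ht => (hd t ht.1).continuousAt.continuousWithinAt) ?_ ?_ <;> rw [interior_Ioo] <;>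
      rintro t ⟨h0, h1⟩
    · exact (hd t h0).differentiableAt.differentiableWithinAt
    · rw [(hd t h0).deriv, ha]
      have h2 : M ^ (p - 2) ≤ t ^ (p - 2) :=
        Real.rpow_le_rpow_of_nonpos h0 h1.le (by linarith)
      have : 0 ≤ p * (p - 1) * (t ^ (p - 2) - M ^ (p - 2)) :=
        mul_nonneg (mul_nonneg (by linarith) (by linarith)) (by linarith)
      linarith
  exact hmono.congr fun t ht => (hasDerivAt_rpow_sub_mul_sq a ht.1).deriv.symm

/-- The variance is controlled by the defect in Jensen's inequality for `t ↦ t ^ p`. -/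
lemma mul_variance_le_rpow_defect {ι E : Type*} [NormedAddCommGroup E] [NormedSpace ℝ E]
    (hp : 1 < p) (hp2 : p ≤ 2) (hM : 0 < M) (s : Finset ι) (κ : ι → ℝ) (v : ι → E)
    (hκ : ∀ i ∈ s, 0 ≤ κ i) (hsum : ∑ i ∈ s, κ i = 1) (hv : ∀ i ∈ s, ‖v i‖ ≤ M) :
    p * (p - 1) / 2 * M ^ (p - 2) * (∑ i ∈ s, κ i * ‖v i‖ ^ 2 - ‖∑ i ∈ s, κ i • v i‖ ^ 2)
      ≤ ∑ i ∈ s, κ i * ‖v i‖ ^ p - ‖∑ i ∈ s, κ i • v i‖ ^ p := by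
  set a := p * (p - 1) / 2 * M ^ (p - 2) with ha
  have hmem : ∀ i ∈ s, ‖v i‖ ∈ Set.Icc (0 : ℝ) M := fun i hi => ⟨norm_nonneg _, hv i hi⟩
  have h1 : ‖∑ i ∈ s, κ i • v i‖ ≤ ∑ i ∈ s, κ i * ‖v i‖ := by
    refine (norm_sum_le _ _).trans (Finset.sum_le_sum fun i hi => ?_)
    rw [norm_smul, Real.norm_of_nonneg (hκ i hi)]
  have h2 : ∑ i ∈ s, κ i * ‖v i‖ ∈ Set.Icc (0 : ℝ) M :=
    (convex_Icc (0 : ℝ) M).sum_mem hκ hsum hmem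
  -- Convexity handles the mean of the norms; monotonicity is needed as well because the norm of the
  -- mean may be smaller.
  have h3 := monotoneOn_rpow_sub_mul_sq hp hp2 hM ⟨norm_nonneg _, h1.trans h2.2⟩ h2 h1
  have h4 := (convexOn_rpow_sub_mul_sq (M := M) hp hp2).map_sum_le hκ hsum hmem
  have h5 := h3.trans h4
  simp only [smul_eq_mul, ← ha] at h5
  simp only [mul_sub, Finset.sum_sub_distrib] at h5
  have h6 : ∑ i ∈ s, κ i * (a * ‖v i‖ ^ 2) = a * ∑ i ∈ s, κ i * ‖v i‖ ^ 2 := by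
    rw [Finset.mul_sum]
    exact Finset.sum_congr rfl fun i _ => by ring
  rw [h6] at h5
  linarith

/-- If one of the weights is at least `ε`, the mean square distance to the corresponding value is
controlled by the variance. -/
lemma sum_norm_sub_sq_le_variance {ι E : Type*} [NormedAddCommGroup E] [InnerProductSpace ℝ E]
    (s : Finset ι) (κ : ι → ℝ) (v : ι → E) (hκ : ∀ i ∈ s, 0 ≤ κ i) (hsum : ∑ i ∈ s, κ i = 1)
    {j : ι} (hj : j ∈ s) {ε : ℝ} (hε : 0 < ε) (hεj : ε ≤ κ j) :
    1 / 2 * ∑ i ∈ s, κ i * ‖v i - v j‖ ^ 2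
      ≤ (1 + 1 / ε) * (∑ i ∈ s, κ i * ‖v i‖ ^ 2 - ‖∑ i ∈ s, κ i • v i‖ ^ 2) := by
  set a := ∑ i ∈ s, κ i • v i with ha
  have hvar : ∑ i ∈ s, κ i * ‖v i‖ ^ 2 - ‖a‖ ^ 2 = ∑ i ∈ s, κ i * ‖v i - a‖ ^ 2 := by
    have h1 : ∀ i ∈ s, κ i * ‖v i - a‖ ^ 2
        = κ i * ‖v i‖ ^ 2 - 2 * inner ℝ (κ i • v i) a + κ i * ‖a‖ ^ 2 := by
      intro i _
      rw [norm_sub_sq_real, real_inner_smul_left]; ring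
    rw [Finset.sum_congr rfl h1, Finset.sum_add_distrib, Finset.sum_sub_distrib,
      ← Finset.mul_sum, ← sum_inner, ← ha, ← Finset.sum_mul, hsum, real_inner_self_eq_norm_sq]
    ring
  rw [hvar]
  set W := ∑ i ∈ s, κ i * ‖v i - a‖ ^ 2 with hW
  -- The single term of index `j` in the variance already controls the distance from `v j` to the
  -- mean.
  have hj2 : ε * ‖v j - a‖ ^ 2 ≤ W :=
    (mul_le_mul_of_nonneg_right hεj (sq_nonneg _)).trans
      (Finset.single_le_sum (f := fun i => κ i * ‖v i - a‖ ^ 2)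
        (fun i hi => mul_nonneg (hκ i hi) (sq_nonneg _)) hj)
  have h2 : ∑ i ∈ s, κ i * ‖v i - v j‖ ^ 2 ≤ 2 * W + 2 * ‖v j - a‖ ^ 2 := by
    have h3 : ∀ i ∈ s, κ i * ‖v i - v j‖ ^ 2
        ≤ 2 * (κ i * ‖v i - a‖ ^ 2) + κ i * (2 * ‖v j - a‖ ^ 2) := by
      intro i hi
      have h4 : ‖v i - v j‖ ≤ ‖v i - a‖ + ‖v j - a‖ := by
        rw [← norm_neg (v j - a)]
        simpa using norm_add_le (v i - a) (-(v j - a))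
      have h5 : ‖v i - v j‖ ^ 2 ≤ 2 * ‖v i - a‖ ^ 2 + 2 * ‖v j - a‖ ^ 2 := by
        nlinarith [norm_nonneg (v i - v j), sq_nonneg (‖v i - a‖ - ‖v j - a‖)]
      nlinarith [mul_le_mul_of_nonneg_left h5 (hκ i hi)]
    refine (Finset.sum_le_sum h3).trans_eq ?_
    rw [Finset.sum_add_distrib, ← Finset.mul_sum, ← Finset.sum_mul, hsum, one_mul]
  have h6 : ‖v j - a‖ ^ 2 ≤ 1 / ε * W := by
    rw [one_div, ← div_eq_inv_mul, le_div_iff₀ hε]; linarith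
  linarith

end StrongConvexity

/-- A power of a product is controlled by a sum of powers. -/
lemma ENNReal.rpow_mul_rpow_half_le {p : ℝ} (hp : 0 < p) (hp2 : p ≤ 2) (a b : ℝ≥0∞) :
    (a ^ (2 - p) * b) ^ (p / 2) ≤ a ^ p + b := by
  -- With this choice `a ≤ t` and `b ≤ t^p`, so the product is at most `t^2`; the endpoint `p = 2`
  -- needs no separate treatment.
  set t := max a (b ^ (1 / p)) with ht
  have h1 : b ≤ t ^ p := by
    calc b = (b ^ (1 / p)) ^ p := by
          rw [← ENNReal.rpow_mul, one_div, inv_mul_cancel₀ hp.ne', ENNReal.rpow_one]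
      _ ≤ t ^ p := ENNReal.rpow_le_rpow (le_max_right _ _) hp.le
  have h2 : a ^ (2 - p) * b ≤ t ^ (2 : ℝ) := by
    calc a ^ (2 - p) * b ≤ t ^ (2 - p) * t ^ p :=
          mul_le_mul' (ENNReal.rpow_le_rpow (le_max_left _ _) (by linarith)) h1
      _ = t ^ (2 : ℝ) := by
          rw [← ENNReal.rpow_add_of_nonneg _ _ (by linarith) hp.le]; congr 1; ring
  calc (a ^ (2 - p) * b) ^ (p / 2) ≤ (t ^ (2 : ℝ)) ^ (p / 2) :=
        ENNReal.rpow_le_rpow h2 (by linarith)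
    _ = t ^ p := by rw [← ENNReal.rpow_mul]; congr 1; ring
    _ ≤ a ^ p + b := by
        rcases max_choice a (b ^ (1 / p)) with h | h <;> rw [ht, h]
        · exact le_self_add
        · rw [← ENNReal.rpow_mul, one_div, inv_mul_cancel₀ hp.ne', ENNReal.rpow_one]
          exact le_add_self

namespace WeightedGraph

/-! ### The Markov operator of a weighted graph -/

variable {Γ : Type*} (G : WeightedGraph Γ)

lemma finite_neighbors (x : Γ) : {y | 0 < G.μ x y}.Finite := by
  obtain ⟨M₀, h⟩ := G.locallyUniformlyFinite
  exact Set.finite_of_encard_le_coe (h x)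

/-- The finite set of neighbors of a vertex. -/
noncomputable def neighborFinset (x : Γ) : Finset Γ := (G.finite_neighbors x).toFinset

@[simp]
lemma mem_neighborFinset {x y : Γ} : y ∈ G.neighborFinset x ↔ 0 < G.μ x y := by
  simp [neighborFinset]

lemma μ_eq_zero_of_notMem {x y : Γ} (h : y ∉ G.neighborFinset x) : G.μ x y = 0 :=
  le_antisymm (not_lt.1 (by simpa using h)) (G.nonneg x y)

lemma m_eq_sum (x : Γ) : G.m x = ∑ y ∈ G.neighborFinset x, G.μ x y :=
  tsum_eq_sum fun _ hy => G.μ_eq_zero_of_notMem hy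

lemma exists_neighbor [Nontrivial Γ] (x : Γ) : ∃ y, 0 < G.μ x y := by
  obtain ⟨y, hy⟩ := exists_ne x
  rcases (G.connected x y).cases_head with h | ⟨z, hz, -⟩
  · exact absurd h.symm hy
  · exact ⟨z, hz⟩

lemma m_pos [Nontrivial Γ] (x : Γ) : 0 < G.m x := by
  obtain ⟨y, hy⟩ := G.exists_neighbor x
  rw [m_eq_sum]
  exact Finset.sum_pos' (fun z _ => G.nonneg x z) ⟨y, by simpa using hy, hy⟩

/-- The transition probability `μ x y / m x`. -/
noncomputable def transition (x y : Γ) : ℝ := G.μ x y / G.m x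

lemma transition_nonneg [Nontrivial Γ] (x y : Γ) : 0 ≤ G.transition x y :=
  div_nonneg (G.nonneg x y) (G.m_pos x).le

lemma transition_eq_zero {x y : Γ} (h : y ∉ G.neighborFinset x) : G.transition x y = 0 := by
  rw [transition, G.μ_eq_zero_of_notMem h, zero_div]

lemma sum_transition [Nontrivial Γ] (x : Γ) :
    ∑ y ∈ G.neighborFinset x, G.transition x y = 1 := by
  simp only [transition]
  rw [← Finset.sum_div, ← m_eq_sum, div_self (G.m_pos x).ne']

lemma kernel_mul_m [Nontrivial Γ] (x y : Γ) : G.kernel x y * G.m y = G.transition x y := by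
  have := (G.m_pos x).ne'
  have := (G.m_pos y).ne'
  rw [kernel, transition]
  field_simp

/-- The transition probability, as an element of `[0, ∞]`. -/
noncomputable def etransition (x y : Γ) : ℝ≥0∞ := ENNReal.ofReal (G.transition x y)

lemma kernelAverage_etransition [Nontrivial Γ] (g : Γ → ℝ) (hg : ∀ x, 0 ≤ g x) (x : Γ) :
    kernelAverage G.etransition (fun y => ENNReal.ofReal (g y)) x
      = ENNReal.ofReal (∑ y ∈ G.neighborFinset x, G.transition x y * g y) := by
  rw [ENNReal.ofReal_sum_of_nonneg fun y _ => mul_nonneg (G.transition_nonneg x y) (hg y)]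
  rw [kernelAverage, tsum_eq_sum fun y hy => by
    rw [etransition, G.transition_eq_zero hy, ENNReal.ofReal_zero, zero_mul]]
  exact Finset.sum_congr rfl fun y _ => (ENNReal.ofReal_mul (G.transition_nonneg x y)).symm

lemma isReversibleKernel [Nontrivial Γ] :
    IsReversibleKernel G.etransition fun x => ENNReal.ofReal (G.m x) where
  finite_support x := by
    refine (G.neighborFinset x).finite_toSet.subset fun y hy => ?_
    by_contra h
    exact hy (by rw [etransition, G.transition_eq_zero h, ENNReal.ofReal_zero])
  tsum_eq_one x := by
    have := G.kernelAverage_etransition (fun _ => 1) (fun _ => zero_le_one) x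
    simpa [kernelAverage, G.sum_transition] using this
  reversible x y := by
    rw [etransition, etransition, ← ENNReal.ofReal_mul (G.m_pos x).le,
      ← ENNReal.ofReal_mul (G.m_pos y).le, transition, transition,
      mul_div_cancel₀ _ (G.m_pos x).ne', mul_div_cancel₀ _ (G.m_pos y).ne', G.symm]
  weight_ne_zero x := by simpa using G.m_pos x

variable {𝕜 : Type*} [RCLike 𝕜]

lemma P_eq_sum [Nontrivial Γ] (f : Γ → 𝕜) (x : Γ) :
    G.P f x = ∑ y ∈ G.neighborFinset x, G.transition x y • f y := by
  simp only [P, kernel_mul_m]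
  rw [tsum_eq_sum fun y hy => by rw [G.transition_eq_zero hy, RCLike.ofReal_zero, zero_mul]]
  exact Finset.sum_congr rfl fun y _ => (RCLike.real_smul_eq_coe_mul _ _).symm

lemma enorm_P_le [Nontrivial Γ] (f : Γ → 𝕜) (x : Γ) :
    ‖G.P f x‖ₑ ≤ kernelAverage G.etransition (fun y => ‖f y‖ₑ) x := by
  simp only [← ofReal_norm]
  rw [G.kernelAverage_etransition _ fun y => norm_nonneg _, P_eq_sum]
  refine ENNReal.ofReal_le_ofReal ((norm_sum_le _ _).trans (Finset.sum_le_sum fun y _ => ?_))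
  rw [norm_smul, Real.norm_of_nonneg (G.transition_nonneg x y)]

lemma enorm_P_iterate_le [Nontrivial Γ] (f : Γ → 𝕜) (n : ℕ) (x : Γ) :
    ‖G.P^[n] f x‖ₑ ≤ (kernelAverage G.etransition)^[n] (fun y => ‖f y‖ₑ) x := by
  induction n generalizing x with
  | zero => rfl
  | succ n ih =>
    rw [Function.iterate_succ_apply', Function.iterate_succ_apply']
    exact (G.enorm_P_le _ x).trans (kernelAverage_mono ih x)

lemma grad_sq [Nontrivial Γ] (f : Γ → 𝕜) (x : Γ) :
    G.grad f x ^ 2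
      = 1 / 2 * ∑ y ∈ G.neighborFinset x, G.transition x y * ‖f y - f x‖ ^ 2 := by
  have h1 : ∑' y, G.kernel x y * ‖f y - f x‖ ^ 2 * G.m y
      = ∑ y ∈ G.neighborFinset x, G.transition x y * ‖f y - f x‖ ^ 2 := by
    have h2 : ∀ y, G.kernel x y * ‖f y - f x‖ ^ 2 * G.m y
        = G.transition x y * ‖f y - f x‖ ^ 2 := fun y => by rw [← kernel_mul_m]; ring
    simp only [h2]
    exact tsum_eq_sum fun y hy => by rw [G.transition_eq_zero hy, zero_mul]
  rw [grad, h1, Real.sq_sqrt]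
  exact mul_nonneg (by norm_num)
    (Finset.sum_nonneg fun y _ => mul_nonneg (G.transition_nonneg x y) (sq_nonneg _))

/-- The defect in Jensen's inequality for the Markov operator and the function `t ↦ t ^ p`. -/
noncomputable def jensenDefect (p : ℝ) (f : Γ → 𝕜) (x : Γ) : ℝ≥0∞ :=
  kernelAverage G.etransition (fun y => ‖f y‖ₑ ^ p) x - ‖G.P f x‖ₑ ^ p

/-- Jensen's inequality ensures that the subtraction defining the defect is not truncated. -/
lemma enorm_P_rpow_add_jensenDefect [Nontrivial Γ] {p : ℝ} (hp : 1 ≤ p) (f : Γ → 𝕜) (x : Γ) :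
    ‖G.P f x‖ₑ ^ p + G.jensenDefect p f x
      = kernelAverage G.etransition (fun y => ‖f y‖ₑ ^ p) x :=
  add_tsub_cancel_of_le ((ENNReal.rpow_le_rpow (G.enorm_P_le f x) (by linarith)).trans
    (G.isReversibleKernel.kernelAverage_rpow_le hp _ x))

/-- The Jensen defects along the orbit of `f` sum up to at most the `p`-th power of its norm. -/
lemma tsum_tsum_jensenDefect_le [Nontrivial Γ] {p : ℝ} (hp : 1 ≤ p) (f : Γ → 𝕜) :
    ∑' x, ENNReal.ofReal (G.m x) * ∑' n, G.jensenDefect p (G.P^[n] f) x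
      ≤ ∑' x, ENNReal.ofReal (G.m x) * ‖f x‖ₑ ^ p := by
  have hstep : ∀ u : Γ → 𝕜, ∑' x, ENNReal.ofReal (G.m x) * ‖G.P u x‖ₑ ^ p
      + ∑' x, ENNReal.ofReal (G.m x) * G.jensenDefect p u x
        = ∑' x, ENNReal.ofReal (G.m x) * ‖u x‖ₑ ^ p := by
    intro u
    rw [← G.isReversibleKernel.tsum_kernelAverage (fun x => ‖u x‖ₑ ^ p), ← ENNReal.tsum_add]
    exact tsum_congr fun x => by rw [← mul_add, G.enorm_P_rpow_add_jensenDefect hp]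
  simp only [← ENNReal.tsum_mul_left]
  rw [ENNReal.tsum_comm, ENNReal.tsum_eq_iSup_nat]
  refine iSup_le fun N => ?_
  -- The telescoping identity, in additive form so that it holds even when the norm of `f` is
  -- infinite.
  have hN : ∑' x, ENNReal.ofReal (G.m x) * ‖G.P^[N] f x‖ₑ ^ p
      + ∑ n ∈ Finset.range N, ∑' x, ENNReal.ofReal (G.m x) * G.jensenDefect p (G.P^[n] f) x
        = ∑' x, ENNReal.ofReal (G.m x) * ‖f x‖ₑ ^ p := by
    induction N with
    | zero => simp
    | succ N ih =>
      rw [Finset.sum_range_succ, add_comm (∑ n ∈ Finset.range N, _), ← add_assoc,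
        Function.iterate_succ_apply', hstep, ih]
  exact le_add_self.trans_eq hN

/-- The gradient is controlled by the Jensen defect. -/
lemma grad_sq_le_jensenDefect [Nontrivial Γ] {p : ℝ} (hp : 1 < p) (hp2 : p ≤ 2) {ε : ℝ}
    (hε : 0 < ε) (hLB : ∀ x, ε * G.m x ≤ G.μ x x) (f : Γ → 𝕜) (x : Γ) {N : ℝ≥0∞} (hN : N ≠ ∞)
    (hfN : ∀ y, 0 < G.μ x y → ‖f y‖ₑ ≤ N) :
    ENNReal.ofReal (G.grad f x) ^ 2
      ≤ ENNReal.ofReal ((1 + 1 / ε) / (p * (p - 1) / 2)) * (N ^ (2 - p) * G.jensenDefect p f x) := by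
  have hp0 : 0 ≤ p := by linarith
  set a := p * (p - 1) / 2 with ha
  have ha0 : 0 < a := by have := sub_pos.2 hp; positivity
  set M := N.toReal with hM
  have hNM : N = ENNReal.ofReal M := (ENNReal.ofReal_toReal hN).symm
  have hM0 : 0 ≤ M := ENNReal.toReal_nonneg
  have hfM : ∀ y ∈ G.neighborFinset x, ‖f y‖ ≤ M := by
    intro y hy
    have := ENNReal.toReal_mono hN (hfN y (by simpa using hy))
    simpa using this
  have hεx : ε ≤ G.transition x x := by
    rw [transition, le_div_iff₀ (G.m_pos x)]; exact hLB x
  have hxx : x ∈ G.neighborFinset x := by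
    by_contra h
    rw [G.transition_eq_zero h] at hεx
    linarith
  rw [← ENNReal.ofReal_pow (show 0 ≤ G.grad f x from Real.sqrt_nonneg _)]
  have hgrad := sum_norm_sub_sq_le_variance (G.neighborFinset x) (G.transition x) f
    (fun y _ => G.transition_nonneg x y) (G.sum_transition x) hxx hε hεx
  rw [← grad_sq, ← P_eq_sum] at hgrad
  -- The cancellation of `M^(2-p)` against `M^(p-2)` needs `M > 0`; if `M = 0`, then `f` vanishes on
  -- the neighbors and so does the gradient.
  rcases hM0.eq_or_lt with hM0 | hM0
  · have hf : ∀ y ∈ G.neighborFinset x, f y = 0 := fun y hy =>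
      norm_le_zero_iff.1 ((hfM y hy).trans_eq hM0.symm)
    have h0 : G.grad f x ^ 2 = 0 := by
      rw [grad_sq, Finset.sum_eq_zero fun y hy => by rw [hf y hy, hf x hxx]; simp, mul_zero]
    rw [h0]; simp
  · have hvar := mul_variance_le_rpow_defect hp hp2 hM0 (G.neighborFinset x) (G.transition x) f
      (fun y _ => G.transition_nonneg x y) (G.sum_transition x) hfM
    rw [← P_eq_sum, ← ha] at hvar
    set W := ∑ y ∈ G.neighborFinset x, G.transition x y * ‖f y‖ ^ 2 - ‖G.P f x‖ ^ 2 with hW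
    set D := ∑ y ∈ G.neighborFinset x, G.transition x y * ‖f y‖ ^ p - ‖G.P f x‖ ^ p with hD
    have hdef : G.jensenDefect p f x = ENNReal.ofReal D := by
      have h1 : ∀ z : 𝕜, ‖z‖ₑ ^ p = ENNReal.ofReal (‖z‖ ^ p) := fun z => by
        rw [← ofReal_norm, ENNReal.ofReal_rpow_of_nonneg (norm_nonneg _) hp0]
      simp only [jensenDefect, h1]
      rw [G.kernelAverage_etransition _ fun y => by positivity,
        ← ENNReal.ofReal_sub _ (by positivity)]
    have hpow : M ^ (2 - p) * M ^ (p - 2) = 1 := by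
      rw [← Real.rpow_add hM0]; simp
    have hWD : W ≤ 1 / a * (M ^ (2 - p) * D) := by
      have h2 : M ^ (2 - p) * (a * M ^ (p - 2) * W) ≤ M ^ (2 - p) * D :=
        mul_le_mul_of_nonneg_left hvar (by positivity)
      have h3 : M ^ (2 - p) * (a * M ^ (p - 2) * W) = a * W := by
        linear_combination (a * W) * hpow
      rw [h3] at h2
      rw [one_div, ← div_eq_inv_mul, le_div_iff₀ ha0]
      linarith
    rw [hdef, hNM, ENNReal.ofReal_rpow_of_pos hM0, ← ENNReal.ofReal_mul (by positivity),
      ← ENNReal.ofReal_mul (by positivity)]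
    refine ENNReal.ofReal_le_ofReal (hgrad.trans ?_)
    calc (1 + 1 / ε) * W ≤ (1 + 1 / ε) * (1 / a * (M ^ (2 - p) * D)) :=
          mul_le_mul_of_nonneg_left hWD (by positivity)
      _ = _ := by ring

/-! ### Maximal functions -/

/-- The maximal inequality for the Markov operator of a graph satisfying (LB). -/
lemma exists_maximal_le [Nontrivial Γ] (hLB : G.LB) {p : ℝ} (hp : 1 < p) :
    ∃ C : ℝ≥0, ∀ g : Γ → ℝ≥0∞, ∑' x, ENNReal.ofReal (G.m x) * g x ^ p ≠ ∞ →
      ∑' x, ENNReal.ofReal (G.m x) * (⨆ n, (kernelAverage G.etransition)^[n] g x) ^ p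
        ≤ C * ∑' x, ENNReal.ofReal (G.m x) * g x ^ p := by
  obtain ⟨ε, hε, hLB⟩ := hLB
  set e := ENNReal.ofReal ε with he
  have he0 : e ≠ 0 := by simpa [he] using hε
  have hpq := Real.HolderConjugate.conjExponent hp
  set q := ENNReal.ofReal p.conjExponent with hq
  set A : ℝ≥0∞ := (e⁻¹) ^ p * (2 * (2 ^ (p - 1) * (2 * (q * (2 * q) ^ (p - 1))))) with hA
  have hAtop : A ≠ ∞ := by
    have h2 : (0 : ℝ) ≤ p - 1 := by linarith
    have hqt : q ≠ ∞ := ENNReal.ofReal_ne_top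
    refine ENNReal.mul_ne_top (ENNReal.rpow_ne_top_of_nonneg (by linarith)
      (ENNReal.inv_ne_top.2 he0)) (ENNReal.mul_ne_top (by simp) (ENNReal.mul_ne_top
      (ENNReal.rpow_ne_top_of_nonneg h2 (by simp)) (ENNReal.mul_ne_top (by simp)
      (ENNReal.mul_ne_top hqt (ENNReal.rpow_ne_top_of_nonneg h2
      (ENNReal.mul_ne_top (by simp) hqt))))))
  refine ⟨A.toNNReal, fun g hg => ?_⟩
  rw [ENNReal.coe_toNNReal hAtop]
  -- (LB) as an operator inequality `ε h ≤ P h`; it bounds the power `2j + 1` by `ε⁻¹` times the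
  -- power `2(j + 1)`.
  have hself : ∀ (h : Γ → ℝ≥0∞) x, e * h x ≤ kernelAverage G.etransition h x := by
    intro h x
    refine le_trans (mul_le_mul_left ?_ _)
      (ENNReal.le_tsum (f := fun y => G.etransition x y * h y) x)
    refine ENNReal.ofReal_le_ofReal ?_
    rw [transition, le_div_iff₀ (G.m_pos x)]
    exact hLB x
  have he1 : e ≤ 1 := by
    rcases isEmpty_or_nonempty Γ with h | ⟨⟨x⟩⟩
    · exact absurd h (not_isEmpty_of_nonempty Γ)
    · simpa [G.isReversibleKernel.kernelAverage_const] using hself (fun _ => 1) x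
  have hsup : ∀ x, (⨆ n, (kernelAverage G.etransition)^[n] g x)
      ≤ e⁻¹ * ⨆ j, (kernelAverage G.etransition)^[2 * j] g x := by
    intro x
    refine iSup_le fun n => ?_
    rw [mul_comm, ← ENNReal.div_le_iff_le_mul (Or.inl (ENNReal.inv_ne_zero.2 ENNReal.ofReal_ne_top))
      (Or.inl (ENNReal.inv_ne_top.2 he0)), div_eq_mul_inv, inv_inv, mul_comm]
    rcases Nat.even_or_odd' n with ⟨j, rfl | rfl⟩
    · refine le_trans ?_ (le_iSup (fun j => (kernelAverage G.etransition)^[2 * j] g x) j)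
      exact mul_le_of_le_one_left' he1
    · refine le_trans ?_ (le_iSup (fun j => (kernelAverage G.etransition)^[2 * j] g x) (j + 1))
      rw [show 2 * (j + 1) = (2 * j + 1) + 1 by ring, Function.iterate_succ_apply' _ (2 * j + 1)]
      exact hself _ x
  calc _ ≤ ∑' x, ENNReal.ofReal (G.m x)
        * (e⁻¹ * ⨆ j, (kernelAverage G.etransition)^[2 * j] g x) ^ p := by
        gcongr with x
        exact hsup x
    _ = (e⁻¹) ^ p * ∑' x, ENNReal.ofReal (G.m x)
        * (⨆ j, (kernelAverage G.etransition)^[2 * j] g x) ^ p := by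
        rw [← ENNReal.tsum_mul_left]
        exact tsum_congr fun x => by
          rw [ENNReal.mul_rpow_of_nonneg _ _ (by linarith)]; ring
    _ ≤ _ := by
        refine (mul_le_mul_right (G.isReversibleKernel.tsum_iSup_even_rpow_le hpq hg) _).trans_eq ?_
        rw [hA]; ring

lemma dist_le_one_of_pos {x y : Γ} (h : 0 < G.μ x y) : G.dist x y ≤ 1 := by
  rw [dist]
  by_cases hxy : x = y
  · simp [hxy]
  · have : G.toSimpleGraph.Adj x y := ⟨hxy, h⟩
    exact (SimpleGraph.dist_eq_one_iff_adj.2 this).le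

/-- Under local doubling, the supremum over the neighbors is bounded in `L^p`. -/
lemma tsum_iSup_neighbor_rpow_le [Nontrivial Γ] {p : ℝ} (hp : 0 < p) {c : ℝ} (hc : 0 < c)
    (hLDV : ∀ x, G.V x 2 ≤ ENNReal.ofReal (c * G.m x)) (F : Γ → ℝ≥0∞) :
    ∑' x, ENNReal.ofReal (G.m x) * (⨆ y, ⨆ _ : 0 < G.μ x y, F y) ^ p
      ≤ ENNReal.ofReal c * ∑' x, ENNReal.ofReal (G.m x) * F x ^ p := by
  classical
  -- The supremum is replaced by a sum. After exchanging sums, `F y ^ p` carries the total mass of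
  -- the neighbors of `y`, which lie in `B(y, 2)`.
  have h1 : ∀ x, (⨆ y, ⨆ _ : 0 < G.μ x y, F y) ^ p
      ≤ ∑' y, if 0 < G.μ x y then F y ^ p else 0 := by
    intro x
    rw [← ENNReal.le_rpow_inv_iff hp]
    refine iSup₂_le fun y hy => ?_
    rw [ENNReal.le_rpow_inv_iff hp]
    refine le_trans ?_ (ENNReal.le_tsum y)
    rw [if_pos hy]
  have h2 : ∀ y, ∑' x, (if 0 < G.μ x y then ENNReal.ofReal (G.m x) else 0)
      ≤ ENNReal.ofReal c * ENNReal.ofReal (G.m y) := by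
    intro y
    rw [← ENNReal.ofReal_mul hc.le]
    refine le_trans ?_ (hLDV y)
    rw [V, volume, tsum_subtype (G.ball y 2) (fun x => ENNReal.ofReal (G.m x))]
    refine ENNReal.tsum_le_tsum fun x => ?_
    split_ifs with h
    · have hd : G.dist y x ≤ 1 := G.dist_le_one_of_pos (G.symm x y ▸ h)
      have hx : x ∈ G.ball y 2 := by
        have : (G.dist y x : ℝ) ≤ 1 := by exact_mod_cast hd
        exact lt_of_le_of_lt this (by norm_num)
      rw [Set.indicator_of_mem hx]
    · exact zero_le
  calc _ ≤ ∑' x, ENNReal.ofReal (G.m x) * ∑' y, (if 0 < G.μ x y then F y ^ p else 0) := by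
        gcongr with x
        exact h1 x
    _ = ∑' y, (∑' x, if 0 < G.μ x y then ENNReal.ofReal (G.m x) else 0) * F y ^ p := by
        simp only [← ENNReal.tsum_mul_left, ← ENNReal.tsum_mul_right]
        rw [ENNReal.tsum_comm]
        refine tsum_congr fun y => tsum_congr fun x => ?_
        split_ifs <;> simp
    _ ≤ ∑' y, ENNReal.ofReal c * ENNReal.ofReal (G.m y) * F y ^ p := by
        gcongr with y
        exact h2 y
    _ = _ := by
        rw [← ENNReal.tsum_mul_left]
        exact tsum_congr fun y => by ring

end WeightedGraph

/-! ### The square function estimate. -/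

theorem theorem2 {Γ : Type*} [Infinite Γ] (G : WeightedGraph Γ) (hLB : G.LB) (hLDV : G.LDV)
    {𝕜 : Type*} [RCLike 𝕜] (p : ℝ) (hp : p ∈ Set.Ioc (1 : ℝ) 2) :
    ∃ C : ℝ≥0, ∀ f : Γ → 𝕜, G.MemLp p f →
      G.lpNorm p (G.gTildeZero f) ≤ (C : ℝ≥0∞) * G.lpNorm p f := by
  obtain ⟨hp1, hp2⟩ := hp
  have hp0 : 0 < p := by linarith
  obtain ⟨C, hC⟩ := G.exists_maximal_le hLB hp1
  obtain ⟨ε, hε, hLB⟩ := hLB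
  obtain ⟨c, hc, hLDV⟩ := hLDV
  set K := (1 + 1 / ε) / (p * (p - 1) / 2) with hK
  set w : Γ → ℝ≥0∞ := fun x => ENNReal.ofReal (G.m x) with hw
  set A : ℝ≥0∞ := ENNReal.ofReal K ^ (p / 2) * (ENNReal.ofReal c * C + 1) with hA
  have hAtop : A ≠ ∞ := ENNReal.mul_ne_top
    (ENNReal.rpow_ne_top_of_nonneg (by linarith) ENNReal.ofReal_ne_top)
    (ENNReal.add_ne_top.2 ⟨ENNReal.mul_ne_top ENNReal.ofReal_ne_top ENNReal.coe_ne_top, by simp⟩)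
  have hAtop' : A ^ (1 / p) ≠ ∞ := ENNReal.rpow_ne_top_of_nonneg (by positivity) hAtop
  refine ⟨(A ^ (1 / p)).toNNReal, fun f hf => ?_⟩
  rw [ENNReal.coe_toNNReal hAtop', WeightedGraph.lpNorm, WeightedGraph.lpNorm,
    ← ENNReal.mul_rpow_of_nonneg _ _ (by positivity)]
  refine ENNReal.rpow_le_rpow ?_ (by positivity)
  have hfin : ∑' x, w x * ‖f x‖ₑ ^ p ≠ ∞ := by
    intro h
    have h' : G.lpNorm p f = ∞ := by
      rw [WeightedGraph.lpNorm]
      simp only [mul_comm _ (ENNReal.ofReal _)]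
      rw [h, ENNReal.top_rpow_of_pos (by positivity)]
    exact hf.ne h'
  set F : Γ → ℝ≥0∞ := fun x => ⨆ n, (kernelAverage G.etransition)^[n] (fun y => ‖f y‖ₑ) x with hF
  set N : Γ → ℝ≥0∞ := fun x => ⨆ y, ⨆ _ : 0 < G.μ x y, F y with hN
  have hNF : ∑' x, w x * N x ^ p ≤ ENNReal.ofReal c * (C * ∑' x, w x * ‖f x‖ₑ ^ p) :=
    (G.tsum_iSup_neighbor_rpow_le hp0 hc hLDV F).trans (mul_le_mul_right (hC _ hfin) _)
  have hNtop : ∀ x, N x ≠ ∞ := G.isReversibleKernel.ne_top_of_tsum_rpow_ne_top hp0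
    (ne_top_of_le_ne_top (ENNReal.mul_ne_top ENNReal.ofReal_ne_top
      (ENNReal.mul_ne_top ENNReal.coe_ne_top hfin)) hNF)
  have hg : ∀ x, ‖G.gTildeZero f x‖ₑ ^ p ≤ ENNReal.ofReal K ^ (p / 2)
      * (N x ^ p + ∑' n, G.jensenDefect p (G.P^[n] f) x) := by
    intro x
    -- `N x` bounds every `P^n f` on the neighbors of `x` at once, so its power factors out of the
    -- sum over `n`.
    have h1 : ∑' n, ENNReal.ofReal (G.grad (G.P^[n] f) x) ^ 2
        ≤ ENNReal.ofReal K * (N x ^ (2 - p) * ∑' n, G.jensenDefect p (G.P^[n] f) x) := by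
      rw [← ENNReal.tsum_mul_left, ← ENNReal.tsum_mul_left]
      refine ENNReal.tsum_le_tsum fun n => ?_
      refine G.grad_sq_le_jensenDefect hp1 hp2 hε hLB _ x (hNtop x) fun y hy => ?_
      exact (G.enorm_P_iterate_le f n y).trans
        ((le_iSup (fun n => (kernelAverage G.etransition)^[n] (fun y => ‖f y‖ₑ) y) n).trans
          (le_iSup₂ (f := fun y (_ : 0 < G.μ x y) => F y) y hy))
    rw [enorm_eq_self, WeightedGraph.gTildeZero, ← ENNReal.rpow_mul,
      show (1 / 2 : ℝ) * p = p / 2 by ring]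
    refine (ENNReal.rpow_le_rpow h1 (by positivity)).trans ?_
    rw [ENNReal.mul_rpow_of_nonneg _ _ (by positivity)]
    exact mul_le_mul_right (ENNReal.rpow_mul_rpow_half_le hp0 hp2 _ _) _
  simp only [mul_comm _ (ENNReal.ofReal _)]
  calc ∑' x, w x * ‖G.gTildeZero f x‖ₑ ^ p
      ≤ ∑' x, w x * (ENNReal.ofReal K ^ (p / 2)
          * (N x ^ p + ∑' n, G.jensenDefect p (G.P^[n] f) x)) := by
        gcongr with x
        exact hg x
    _ = ENNReal.ofReal K ^ (p / 2) * (∑' x, w x * N x ^ p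
          + ∑' x, w x * ∑' n, G.jensenDefect p (G.P^[n] f) x) := by
        rw [← ENNReal.tsum_add, ← ENNReal.tsum_mul_left]
        exact tsum_congr fun x => by ring
    _ ≤ ENNReal.ofReal K ^ (p / 2) * (ENNReal.ofReal c * (C * ∑' x, w x * ‖f x‖ₑ ^ p)
          + ∑' x, w x * ‖f x‖ₑ ^ p) := by
        exact mul_le_mul_right (add_le_add hNF (G.tsum_tsum_jensenDefect_le hp1.le f)) _
    _ = A * ∑' x, w x * ‖f x‖ₑ ^ p := by rw [hA]; ring
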